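/- Let $X_1,\dots,X_n$ ($n\ge 1$) be i.i.d. random variables with the $N(\mu,\sigma^2)$ distribution, where $\mu\in\mathbb R$, $\sigma>0$, and consider the model with both parameters unknown: $\theta_0=(\mu,\sigma^2)$ is the true value of the parameter and $\Theta=\mathbb R\times(0,\infty)$ is the parameter space. Let $$\hat\theta_n(X)=\Big(\bar X,\ \tfrac1n\sum_{i=1}^n (X_i-\bar X)^2\Big)^{\intercal},\qquad \bar X=\tfrac1n\sum_{i=1}^n X_i ,$$ and let $I(\theta)=\big(\mathrm E_\theta[-\partial_{\theta_r}\partial_{\theta_s}\log f(X_1|\theta)]\big)_{r,s=1,2}$ be the expected Fisher information matrix of one observation, where $f(\cdot|\theta)$ is the normal density with parameter $\theta$; $[I(\theta_0)]^{1/2}$ is its positive semidefinite square root. (a) If $n\ge 2$, then almost surely $\hat\theta_n(X)$ is the unique maximiser over $\Theta$ of the likelihood $L(\theta;X)=\prod_{i=1}^n f(X_i|\theta)$, i.e. the unique maximum likelihood estimate. (b) Let $Z\sim N_2(0,I_{2\times 2})$ and let $h:\mathbb R^2\to\mathbb R$ be three times differentiable with bounded partial derivatives of orders 1, 2, 3.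 Write $\|\cdot\|$ for the supremum norm (with value $+\infty$ for an unbounded function), $\|h\|_1=\sup_i\|\partial_i h\|$, $\|h\|_2=\sup_{i,j}\|\partial_i\partial_j h\|$, $\|h\|_3=\sup_{i,j,k}\|\partial_i\partial_j\partial_k h\|$. Then $h\big(\sqrt n\,[I(\theta_0)]^{1/2}(\hat\theta_n(X)-\theta_0)\big)$ and $h(Z)$ are integrable and $$ \begin{aligned} &\Big|\mathrm E\big[h\big(\sqrt n\,[I(\theta_0)]^{1/2}(\hat\theta_n(X)-\theta_0)\big)\big]-\mathrm E[h(Z)]\Big| \le \frac52\frac{\|h\|_2}{\sqrt n}+19\frac{\|h\|_3}{\sqrt n}+8\frac{\|h\|}{n\sigma^2}\,(1+2\sigma^2)+4\sqrt2\,\frac{\|h\|_1}{\sqrt n}\\ &\qquad+4\frac{\|h\|_1}{\sqrt n}\Big[\sqrt2+\sqrt{\tfrac32}+16\sqrt2\sqrt{\tfrac1n+\tfrac{\sigma^2}{4}}\,\Big] +32\frac{\|h\|_1}{\sqrt n}\Big[1+648\Big[\Big(\tfrac32+\tfrac{\sigma^2}{4}\Big)^2+\tfrac{3}{n^2}\Big]\Big]^{1/2}.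 \end{aligned} $$ -/

import Mathlib

open MeasureTheory ProbabilityTheory
open scoped ENNReal MatrixOrder

noncomputable section

namespace NormalMLE

/-- The `i`-th partial derivative of `g : ℝᵈ → ℝ`, as a function on `ℝᵈ`. -/
def partialDeriv {d : ℕ} (i : Fin d) (g : EuclideanSpace ℝ (Fin d) → ℝ) :
    EuclideanSpace ℝ (Fin d) → ℝ :=
  fun x => lineDeriv ℝ g x (EuclideanSpace.single i 1)

/-- The supremum norm of a real function, with value `∞` for unbounded functions. -/
def supNorm {d : ℕ} (g : EuclideanSpace ℝ (Fin d) → ℝ) : ℝ≥0∞ :=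
  ⨆ x, ‖g x‖ₑ

/-- `‖h‖₁ = sup_i ‖∂_i h‖`. -/
def supNorm₁ {d : ℕ} (h : EuclideanSpace ℝ (Fin d) → ℝ) : ℝ≥0∞ :=
  ⨆ i, supNorm (partialDeriv i h)

/-- `‖h‖₂ = sup_{i,j} ‖∂_i ∂_j h‖`. -/
def supNorm₂ {d : ℕ} (h : EuclideanSpace ℝ (Fin d) → ℝ) : ℝ≥0∞ :=
  ⨆ i, ⨆ j, supNorm (partialDeriv i (partialDeriv j h))

/-- `‖h‖₃ = sup_{i,j,k} ‖∂_i ∂_j ∂_k h‖`. -/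
def supNorm₃ {d : ℕ} (h : EuclideanSpace ℝ (Fin d) → ℝ) : ℝ≥0∞ :=
  ⨆ i, ⨆ j, ⨆ k, supNorm (partialDeriv i (partialDeriv j (partialDeriv k h)))

/-- The class of test functions: three times differentiable functions `h : ℝᵈ → ℝ` whose partial
derivatives of orders one, two and three are bounded. -/
structure IsTestFunction {d : ℕ} (h : EuclideanSpace ℝ (Fin d) → ℝ) : Prop where
  differentiable : Differentiable ℝ h
  differentiable_first : ∀ i, Differentiable ℝ (partialDeriv i h)
  differentiable_second : ∀ i j, Differentiable ℝ (partialDeriv i (partialDeriv j h))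
  bounded_first : supNorm₁ h < ∞
  bounded_second : supNorm₂ h < ∞
  bounded_third : supNorm₃ h < ∞

/-- The parameter space of the model `N(μ, σ²)`, with parameter `θ = (μ, σ²)`:
`Θ = ℝ × (0, ∞)`. -/
def paramSpace : Set (EuclideanSpace ℝ (Fin 2)) :=
  {θ | 0 < θ 1}

/-- The density `f(x | θ)` of `N(μ, σ²)` at the parameter `θ = (μ, σ²)`. -/
def density (θ : EuclideanSpace ℝ (Fin 2)) (x : ℝ) : ℝ :=
  gaussianPDFReal (θ 0) (θ 1).toNNReal x

/-- The law `N(μ, σ²)` with parameter `θ = (μ, σ²)`. -/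
def law (θ : EuclideanSpace ℝ (Fin 2)) : Measure ℝ :=
  gaussianReal (θ 0) (θ 1).toNNReal

/-- The likelihood `L(θ; x) = ∏ᵢ f(xᵢ | θ)` of the data `x = (x₁, …, xₙ)`. -/
def likelihood {n : ℕ} (x : Fin n → ℝ) (θ : EuclideanSpace ℝ (Fin 2)) : ℝ :=
  ∏ i, density θ (x i)

/-- `t` is a maximum likelihood estimate for the data `x`: it lies in the parameter space and
maximises the likelihood there. -/
def IsMLE {n : ℕ} (x : Fin n → ℝ) (t : EuclideanSpace ℝ (Fin 2)) : Prop :=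
  t ∈ paramSpace ∧ IsMaxOn (likelihood x) paramSpace t

/-- The sample mean. -/
def sampleMean {n : ℕ} (x : Fin n → ℝ) : ℝ :=
  (∑ i, x i) / n

/-- The estimator `(x̄, (1/n) ∑ᵢ (xᵢ - x̄)²)`. -/
def estimator {n : ℕ} (x : Fin n → ℝ) : EuclideanSpace ℝ (Fin 2) :=
  !₂[sampleMean x, (∑ i, (x i - sampleMean x) ^ 2) / n]

/-- The expected Fisher information matrix of one observation,
`I(θ)_{rs} = E_θ[-∂²/∂θ_r∂θ_s log f(X | θ)]`. -/
def fisherInformation (θ : EuclideanSpace ℝ (Fin 2)) : Matrix (Fin 2) (Fin 2) ℝ :=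
  Matrix.of fun r s =>
    ∫ x, -partialDeriv r (partialDeriv s fun t => Real.log (density t x)) θ ∂(law θ)

/-- `√n I(θ₀)^{1/2} (t - θ₀)`, with the positive semidefinite square root of the matrix. -/
def standardize (n : ℕ) (θ₀ t : EuclideanSpace ℝ (Fin 2)) : EuclideanSpace ℝ (Fin 2) :=
  √(n : ℝ) • Matrix.toEuclideanCLM (𝕜 := ℝ) (CFC.sqrt (fisherInformation θ₀)) (t - θ₀)

end NormalMLE

end

/-! With `Y i = (X i - μ) / σ` and `I(θ₀) = diag(1/σ², 1/(2σ⁴))`, the standardized estimator is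
exactly `n^{-1/2} ∑ scoreVector (Y i)` minus `R² / (√2 √n)` in the second coordinate, where `R =
n^{-1/2} ∑ Y i` (`standardize_estimator`). Since `E R² = 1` and `h` is Lipschitz, the correction
costs at most `‖h‖₁ / √n`.

The score vectors `(Y, (Y² - 1)/√2)` are i.i.d. with mean zero and identity covariance. Lindeberg's
replacement of summands by standard Gaussian vectors, with a second-order Taylor expansion at each
replacement, then costs at most `10 ‖h‖₃ / √n` (`IsTestFunction.abs_integral_sum_sub_le`). The
resulting bound does not involve `σ` and is dominated by two of the six terms on the right-hand
side.

For part (a), the log-likelihood depends on the data only through the estimator, and `log r < r - 1`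
for `r ≠ 1` makes the estimator the strict maximiser as soon as the sample variance is positive.
This holds almost surely, because two independent observations almost surely differ. -/

namespace NormalMLE

/-! ### Taylor expansion and growth of test functions. -/

/-- Taylor's formula of order two on `[0, 1]`, with a bound on the third derivative. -/
theorem abs_taylor_two_le {f f₁ f₂ f₃ : ℝ → ℝ} {M : ℝ}
    (h₁ : ∀ t, HasDerivAt f (f₁ t) t) (h₂ : ∀ t, HasDerivAt f₁ (f₂ t) t)
    (h₃ : ∀ t, HasDerivAt f₂ (f₃ t) t) (hM : ∀ t, |f₃ t| ≤ M) :
    |f 1 - f 0 - f₁ 0 - f₂ 0 / 2| ≤ M / 6 := by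
  -- The third derivative need not be continuous, so there is no integral remainder. Instead the
  -- mean value inequality is applied three times, raising the bound to `M t`, `M t² / 2` and `M t³
  -- / 6`.
  have e₂ : ∀ t ∈ Set.Icc (0 : ℝ) 1, ‖f₂ t - f₂ 0‖ ≤ M * t := by
    refine image_norm_le_of_norm_deriv_right_le_deriv_boundary (f' := f₃) (B' := fun _ => M)
      (fun t _ => ((h₃ t).sub_const _).continuousAt.continuousWithinAt)
      (fun t _ => ((h₃ t).sub_const _).hasDerivWithinAt) (by simp)
      (fun t => by simpa using (hasDerivAt_id t).const_mul M) (fun t _ => hM t)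
  have d₁ : ∀ t, HasDerivAt (fun t => f₁ t - f₁ 0 - f₂ 0 * t) (f₂ t - f₂ 0) t := fun t => by
    simpa using ((h₂ t).sub_const (f₁ 0)).fun_sub ((hasDerivAt_id t).const_mul (f₂ 0))
  have e₁ : ∀ t ∈ Set.Icc (0 : ℝ) 1, ‖f₁ t - f₁ 0 - f₂ 0 * t‖ ≤ M * t ^ 2 / 2 := by
    refine image_norm_le_of_norm_deriv_right_le_deriv_boundary
      (f' := fun t => f₂ t - f₂ 0) (B' := fun t => M * t)
      (fun t _ => (d₁ t).continuousAt.continuousWithinAt)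
      (fun t _ => (d₁ t).hasDerivWithinAt) (by simp)
      (fun t => ?_) (fun t ht => e₂ t (Set.Ico_subset_Icc_self ht))
    exact (((hasDerivAt_pow 2 t).const_mul M).div_const 2).congr_deriv (by push_cast; ring)
  have d₀ : ∀ t, HasDerivAt (fun t => f t - f 0 - f₁ 0 * t - f₂ 0 * t ^ 2 / 2)
      (f₁ t - f₁ 0 - f₂ 0 * t) t := fun t => by
    exact ((((h₁ t).sub_const (f 0)).fun_sub ((hasDerivAt_id t).const_mul (f₁ 0))).fun_sub
      (((hasDerivAt_pow 2 t).const_mul (f₂ 0)).div_const 2)).congr_deriv (by push_cast; ring)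
  have e₀ : ∀ t ∈ Set.Icc (0 : ℝ) 1,
      ‖f t - f 0 - f₁ 0 * t - f₂ 0 * t ^ 2 / 2‖ ≤ M * t ^ 3 / 6 := by
    refine image_norm_le_of_norm_deriv_right_le_deriv_boundary
      (f' := fun t => f₁ t - f₁ 0 - f₂ 0 * t) (B' := fun t => M * t ^ 2 / 2)
      (fun t _ => (d₀ t).continuousAt.continuousWithinAt)
      (fun t _ => (d₀ t).hasDerivWithinAt) (by simp)
      (fun t => ?_) (fun t ht => e₁ t (Set.Ico_subset_Icc_self ht))
    exact (((hasDerivAt_pow 3 t).const_mul M).div_const 6).congr_deriv (by push_cast; ring)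
  simpa using e₀ 1 (by simp)

section TestFunctions

variable {d : ℕ} {g h : EuclideanSpace ℝ (Fin d) → ℝ}

theorem abs_le_toReal_of_enorm_le {r : ℝ} {M : ℝ≥0∞} (hM : M < ∞) (hr : ‖r‖ₑ ≤ M) :
    |r| ≤ M.toReal := by
  rw [← Real.norm_eq_abs, ← toReal_enorm]
  exact ENNReal.toReal_mono hM.ne hr

theorem IsTestFunction.abs_partialDeriv_le (hh : IsTestFunction h) (i : Fin d)
    (x : EuclideanSpace ℝ (Fin d)) : |partialDeriv i h x| ≤ (supNorm₁ h).toReal :=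
  abs_le_toReal_of_enorm_le hh.bounded_first <|
    (le_iSup (fun x => ‖partialDeriv i h x‖ₑ) x).trans
      (le_iSup (fun i => supNorm (partialDeriv i h)) i)

theorem IsTestFunction.abs_partialDeriv₃_le (hh : IsTestFunction h) (i j k : Fin d)
    (x : EuclideanSpace ℝ (Fin d)) :
    |partialDeriv i (partialDeriv j (partialDeriv k h)) x| ≤ (supNorm₃ h).toReal :=
  abs_le_toReal_of_enorm_le hh.bounded_third <|
    (le_iSup (fun x => ‖partialDeriv i (partialDeriv j (partialDeriv k h)) x‖ₑ) x).trans <|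
    (le_iSup (fun k => supNorm (partialDeriv i (partialDeriv j (partialDeriv k h)))) k).trans <|
    (le_iSup (fun j => ⨆ k, supNorm (partialDeriv i (partialDeriv j (partialDeriv k h)))) j).trans
      (le_iSup (fun i => ⨆ j, ⨆ k,
        supNorm (partialDeriv i (partialDeriv j (partialDeriv k h)))) i)

/-- The derivative is expressed through `partialDeriv`, so that the formula can be iterated on the
partial derivatives themselves. -/
theorem hasDerivAt_comp_line (hg : Differentiable ℝ g) (x a : EuclideanSpace ℝ (Fin d)) (t : ℝ) :
    HasDerivAt (fun t : ℝ => g (x + t • a)) (∑ i, a i * partialDeriv i g (x + t • a)) t := by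
  have hl : HasDerivAt (fun t : ℝ => x + t • a) a t := by
    simpa using ((hasDerivAt_id t).smul_const a).const_add x
  refine ((hg (x + t • a)).hasFDerivAt.comp_hasDerivAt t hl).congr_deriv ?_
  have hsum : ∀ L : EuclideanSpace ℝ (Fin d) →L[ℝ] ℝ,
      L a = ∑ i, a i * L (EuclideanSpace.single i 1) := fun L => by
    conv_lhs => rw [← (EuclideanSpace.basisFun (Fin d) ℝ).sum_repr a, map_sum]
    simp
  rw [hsum]
  simp only [partialDeriv, (hg (x + t • a)).lineDeriv_eq_fderiv]

theorem IsTestFunction.abs_taylor_le (hh : IsTestFunction h) (x a : EuclideanSpace ℝ (Fin d)) :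
    |h (x + a) - h x - ∑ i, a i * partialDeriv i h x
      - (∑ i, ∑ j, a i * a j * partialDeriv j (partialDeriv i h) x) / 2|
      ≤ (supNorm₃ h).toReal * (∑ i, |a i|) ^ 3 / 6 := by
  have key := abs_taylor_two_le (M := (supNorm₃ h).toReal * (∑ i, |a i|) ^ 3)
    (hasDerivAt_comp_line hh.differentiable x a)
    (fun t => HasDerivAt.fun_sum (u := Finset.univ) fun i _ =>
      (hasDerivAt_comp_line (hh.differentiable_first i) x a t).const_mul (a i))
    (fun t => HasDerivAt.fun_sum (u := Finset.univ) fun i _ =>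
      (HasDerivAt.fun_sum (u := Finset.univ) fun j _ =>
        (hasDerivAt_comp_line (hh.differentiable_second j i) x a t).const_mul (a j)).const_mul
          (a i)) ?_
  · simpa [Finset.mul_sum, mul_assoc] using key
  · intro t
    -- The cube is unfolded into a triple sum to match the third derivative along the line term by
    -- term.
    have : (∑ i, |a i|) ^ 3 = ∑ i, |a i| * ∑ j, |a j| * ∑ k, |a k| := by
      simp only [← Finset.sum_mul]; ring
    rw [this, Finset.mul_sum]
    refine (Finset.abs_sum_le_sum_abs _ _).trans (Finset.sum_le_sum fun i _ => ?_)
    rw [abs_mul, mul_left_comm]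
    refine mul_le_mul_of_nonneg_left ?_ (abs_nonneg _)
    rw [Finset.mul_sum]
    refine (Finset.abs_sum_le_sum_abs _ _).trans (Finset.sum_le_sum fun j _ => ?_)
    rw [abs_mul, mul_left_comm]
    refine mul_le_mul_of_nonneg_left ?_ (abs_nonneg _)
    rw [Finset.mul_sum]
    refine (Finset.abs_sum_le_sum_abs _ _).trans (Finset.sum_le_sum fun k _ => ?_)
    rw [abs_mul, mul_comm]
    exact mul_le_mul_of_nonneg_right (hh.abs_partialDeriv₃_le _ _ _ _) (abs_nonneg _)

theorem IsTestFunction.abs_add_sub_le (hh : IsTestFunction h) (x a : EuclideanSpace ℝ (Fin d)) :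
    |h (x + a) - h x| ≤ (supNorm₁ h).toReal * ∑ i, |a i| := by
  have := norm_image_sub_le_of_norm_deriv_le_segment_01'
    (f := fun t : ℝ => h (x + t • a)) (C := (supNorm₁ h).toReal * ∑ i, |a i|)
    (fun t _ => (hasDerivAt_comp_line hh.differentiable x a t).hasDerivWithinAt) ?_
  · simpa using this
  · intro t _
    rw [Finset.mul_sum]
    refine (Finset.abs_sum_le_sum_abs _ _).trans (Finset.sum_le_sum fun i _ => ?_)
    rw [abs_mul, mul_comm]
    exact mul_le_mul_of_nonneg_right (hh.abs_partialDeriv_le _ _) (abs_nonneg _)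

/-- Bounded first derivatives give at most linear growth; `h` itself may be unbounded. -/
theorem IsTestFunction.integrable_comp {Ω : Type*} [MeasurableSpace Ω] {P : Measure Ω}
    [IsFiniteMeasure P] (hh : IsTestFunction h) {V : Ω → EuclideanSpace ℝ (Fin d)}
    (hV : Integrable V P) : Integrable (fun ω => h (V ω)) P := by
  have hi : ∀ i, Integrable (fun ω => V ω i) P := fun i =>
    (EuclideanSpace.proj (𝕜 := ℝ) i).integrable_comp hV
  have hb : Integrable (fun ω => |h 0| + (supNorm₁ h).toReal * ∑ i, |V ω i|) P :=
    (integrable_const _).add ((integrable_finsetSum _ fun i _ => (hi i).abs).const_mul _)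
  refine hb.mono' (hh.differentiable.continuous.comp_aestronglyMeasurable hV.1)
    (Filter.Eventually.of_forall fun ω => ?_)
  have := hh.abs_add_sub_le 0 (V ω)
  rw [zero_add] at this
  have h2 := abs_add_le (h (V ω) - h 0) (h 0)
  rw [sub_add_cancel] at h2
  rw [Real.norm_eq_abs]
  linarith

end TestFunctions

/-! ### Lindeberg's replacement argument. -/

section Lindeberg

variable {d : ℕ} {h : EuclideanSpace ℝ (Fin d) → ℝ}

/-- Two laws with the same moments of orders one and two: comparison of the integrals of a test
function at a small scale. -/
theorem IsTestFunction.abs_integral_sub_integral_le (hh : IsTestFunction h)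
    {μ ν : Measure (EuclideanSpace ℝ (Fin d))} [IsProbabilityMeasure μ] [IsProbabilityMeasure ν]
    (hμ : ∀ i, MemLp (fun a => a i) 3 μ) (hν : ∀ i, MemLp (fun a => a i) 3 ν)
    (h₁ : ∀ i, ∫ a, a i ∂μ = ∫ a, a i ∂ν)
    (h₂ : ∀ i j, ∫ a, a i * a j ∂μ = ∫ a, a i * a j ∂ν)
    {c : ℝ} (hc : 0 ≤ c) (x : EuclideanSpace ℝ (Fin d)) :
    |∫ a, h (x + c • a) ∂μ - ∫ a, h (x + c • a) ∂ν| ≤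
      c ^ 3 * (supNorm₃ h).toReal / 6 *
        (∫ a, (∑ i, |a i|) ^ 3 ∂μ + ∫ a, (∑ i, |a i|) ^ 3 ∂ν) := by
  set K := c ^ 3 * (supNorm₃ h).toReal / 6 with hK
  -- `q` is the second-order Taylor polynomial of `a ↦ h (x + c • a)`. Its integral involves only
  -- moments of orders one and two, so it is the same under `μ` and `ν`, and only the cubic
  -- remainders survive.
  set q : EuclideanSpace ℝ (Fin d) → ℝ := fun a => h x + ∑ i, c * partialDeriv i h x * a i
    + ∑ i, ∑ j, c ^ 2 * partialDeriv j (partialDeriv i h) x / 2 * (a i * a j) with hq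
  have taylor : ∀ a, |h (x + c • a) - q a| ≤ K * (∑ i, |a i|) ^ 3 := by
    intro a
    convert hh.abs_taylor_le x (c • a) using 1
    · rw [hq]
      congr 1
      simp only [PiLp.smul_apply, smul_eq_mul, Finset.sum_div]
      rw [← sub_sub, ← sub_sub]
      congr 1
      · congr 1
        exact Finset.sum_congr rfl fun i _ => by ring
      · exact Finset.sum_congr rfl fun i _ => Finset.sum_congr rfl fun j _ => by ring
    · simp only [PiLp.smul_apply, smul_eq_mul, abs_mul, abs_of_nonneg hc, ← Finset.mul_sum, hK]
      ring
  have aux : ∀ (ρ : Measure (EuclideanSpace ℝ (Fin d))) [IsProbabilityMeasure ρ],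
      (∀ i, MemLp (fun a => a i) 3 ρ) →
      (∫ a, q a ∂ρ = h x + ∑ i, c * partialDeriv i h x * ∫ a, a i ∂ρ
        + ∑ i, ∑ j, c ^ 2 * partialDeriv j (partialDeriv i h) x / 2 * ∫ a, a i * a j ∂ρ) ∧
      |∫ a, h (x + c • a) ∂ρ - ∫ a, q a ∂ρ| ≤ K * ∫ a, (∑ i, |a i|) ^ 3 ∂ρ := by
    intro ρ _ hρ
    have i₁ : ∀ i, Integrable (fun a : EuclideanSpace ℝ (Fin d) => a i) ρ := fun i =>
      (hρ i).integrable (by norm_num)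
    have i₂ : ∀ i j, Integrable (fun a : EuclideanSpace ℝ (Fin d) => a i * a j) ρ := fun i j =>
      ((hρ i).mono_exponent (p := 2) (by norm_num)).integrable_mul
        ((hρ j).mono_exponent (p := 2) (by norm_num))
    have i₃ : Integrable (fun a : EuclideanSpace ℝ (Fin d) => (∑ i, |a i|) ^ 3) ρ := by
      have := (memLp_finsetSum Finset.univ fun i _ => (hρ i).abs).integrable_norm_pow (p := 3)
        (by norm_num)
      refine this.congr (Filter.Eventually.of_forall fun a => ?_)
      change ‖∑ i, |a i|‖ ^ 3 = _
      rw [Real.norm_of_nonneg (Finset.sum_nonneg fun i _ => abs_nonneg _)]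
    have j₁ : Integrable (fun a : EuclideanSpace ℝ (Fin d) =>
        ∑ i, c * partialDeriv i h x * a i) ρ :=
      integrable_finsetSum _ fun i _ => (i₁ i).const_mul _
    have j₂ : Integrable (fun a : EuclideanSpace ℝ (Fin d) => ∑ i, ∑ j,
        c ^ 2 * partialDeriv j (partialDeriv i h) x / 2 * (a i * a j)) ρ :=
      integrable_finsetSum _ fun i _ => integrable_finsetSum _ fun j _ => (i₂ i j).const_mul _
    have iq : Integrable q ρ := ((integrable_const _).add j₁).add j₂
    have ih : Integrable (fun a => h (x + c • a)) ρ := by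
      have hm : Measurable (fun a => h (x + c • a)) :=
        (hh.differentiable.continuous.comp (by fun_prop)).measurable
      have : Integrable (fun a => h (x + c • a) - q a) ρ :=
        (i₃.const_mul K).mono' (hm.aestronglyMeasurable.sub iq.1)
          (Filter.Eventually.of_forall taylor)
      exact (this.add iq).congr (Filter.Eventually.of_forall fun a => sub_add_cancel _ _)
    refine ⟨?_, ?_⟩
    · have s₁ : ∫ a, q a ∂ρ = _ := integral_add ((integrable_const (h x)).add j₁) j₂
      have s₂ := integral_add (integrable_const (μ := ρ) (h x)) j₁
      rw [s₁, s₂, integral_const,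
        integral_finsetSum _ fun i _ => (i₁ i).const_mul _,
        integral_finsetSum _ fun i _ => integrable_finsetSum _ fun j _ => (i₂ i j).const_mul _]
      simp only [probReal_univ, one_smul, integral_const_mul]
      congr 1
      refine Finset.sum_congr rfl fun i _ => ?_
      rw [integral_finsetSum _ fun j _ => (i₂ i j).const_mul _]
      simp only [integral_const_mul]
    · rw [← integral_sub ih iq, ← integral_const_mul]
      exact norm_integral_le_of_norm_le (i₃.const_mul K) 
        (Filter.Eventually.of_forall fun a => (Real.norm_eq_abs _).trans_le (taylor a))
  obtain ⟨qμ, bμ⟩ := aux μ hμ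
  obtain ⟨qν, bν⟩ := aux ν hν
  have e : ∫ a, q a ∂μ = ∫ a, q a ∂ν := by simp only [qμ, qν, h₁, h₂]
  rw [e] at bμ
  rw [abs_le] at *
  constructor <;> linarith [bμ.1, bμ.2, bν.1, bν.2]

theorem integrable_id_conv {E : Type*} [NormedAddCommGroup E] [MeasurableSpace E] [BorelSpace E]
    [SecondCountableTopology E] {μ ν : Measure E} [IsFiniteMeasure μ] [IsFiniteMeasure ν]
    (hμ : Integrable id μ) (hν : Integrable id ν) : Integrable id (μ ∗ ν) := by
  rw [Measure.conv, integrable_map_measure aestronglyMeasurable_id (by fun_prop)]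
  exact (hμ.comp_fst ν).add (hν.comp_snd μ)

/-- Uniform comparisons of integrals of shifts of a function add up under convolution. -/
theorem IsTestFunction.abs_integral_conv_sub_le (hh : IsTestFunction h)
    {μ ν μ' ν' : Measure (EuclideanSpace ℝ (Fin d))} [IsProbabilityMeasure μ]
    [IsProbabilityMeasure ν] [IsProbabilityMeasure μ'] [IsProbabilityMeasure ν']
    (iμ : Integrable id μ) (iν : Integrable id ν) (iμ' : Integrable id μ') (iν' : Integrable id ν')
    {c ε ε' : ℝ}
    (hε : ∀ x, |∫ a, h (x + c • a) ∂μ - ∫ a, h (x + c • a) ∂ν| ≤ ε)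
    (hε' : ∀ x, |∫ a, h (x + c • a) ∂μ' - ∫ a, h (x + c • a) ∂ν'| ≤ ε')
    (x : EuclideanSpace ℝ (Fin d)) :
    |∫ a, h (x + c • a) ∂(μ ∗ μ') - ∫ a, h (x + c • a) ∂(ν ∗ ν')| ≤ ε + ε' := by
  have int : ∀ {ρ : Measure (EuclideanSpace ℝ (Fin d))} [IsProbabilityMeasure ρ]
      (_ : Integrable id ρ), Integrable (fun a => h (x + c • a)) ρ := fun hρ =>
    hh.integrable_comp ((integrable_const _).add (hρ.smul c))
  -- Replacing one factor: with the `τ`-variable `b` frozen, the hypothesis is used at the base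
  -- point `x + c • b`. This is why the comparisons must be uniform in `x`.
  have one : ∀ {ρ ρ' τ : Measure (EuclideanSpace ℝ (Fin d))} [IsProbabilityMeasure ρ]
      [IsProbabilityMeasure ρ'] [IsProbabilityMeasure τ] (_ : Integrable id ρ)
      (_ : Integrable id ρ') (_ : Integrable id τ) {δ : ℝ}
      (_ : ∀ x, |∫ a, h (x + c • a) ∂ρ - ∫ a, h (x + c • a) ∂ρ'| ≤ δ),
      |∫ a, h (x + c • a) ∂(τ ∗ ρ) - ∫ a, h (x + c • a) ∂(τ ∗ ρ')| ≤ δ := by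
    intro ρ ρ' τ _ _ _ hρ hρ' hτ δ hδ
    have int_conv : ∀ {ρ : Measure (EuclideanSpace ℝ (Fin d))} [IsProbabilityMeasure ρ]
        (_ : Integrable id ρ), Integrable (fun a => h (x + c • a)) (τ ∗ ρ) := fun hρ =>
      int (integrable_id_conv hτ hρ)
    have k : ∀ {ρ : Measure (EuclideanSpace ℝ (Fin d))} [IsProbabilityMeasure ρ]
        (_ : Integrable id ρ), Integrable (fun b => ∫ a, h (x + c • (b + a)) ∂ρ) τ := by
      intro ρ _ hρ
      have := (integrable_map_measure (int_conv hρ).1 (by fun_prop)).1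
        (int_conv hρ)
      exact this.integral_prod_left
    rw [integral_conv (int_conv hρ),
      integral_conv (int_conv hρ'), ← integral_sub (k hρ) (k hρ')]
    have := norm_integral_le_of_norm_le_const (μ := τ) (C := δ)
      (f := fun b => ∫ a, h (x + c • (b + a)) ∂ρ - ∫ a, h (x + c • (b + a)) ∂ρ')
      (Filter.Eventually.of_forall fun b => by
        simpa [smul_add, add_assoc] using hδ (x + c • b))
    simpa using this
  have a₁ := one iμ' iν' iμ hε'
  have a₂ := one iμ iν iν' hε
  -- The intermediate law is `μ ∗ ν'`; commutativity lets `one` replace the other factor too.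
  rw [Measure.conv_comm ν' μ, Measure.conv_comm ν' ν] at a₂
  have := abs_sub_le (∫ a, h (x + c • a) ∂(μ ∗ μ')) (∫ a, h (x + c • a) ∂(μ ∗ ν'))
    (∫ a, h (x + c • a) ∂(ν ∗ ν'))
  linarith

/-- Variances add: `1 + (√k)² = (√(k+1))²`. This makes the Gaussian side of the replacement grow by
one summand. -/
theorem stdGaussian_map_sqrt_conv {E : Type*} [NormedAddCommGroup E] [InnerProductSpace ℝ E]
    [FiniteDimensional ℝ E] [MeasurableSpace E] [BorelSpace E] (k : ℕ) :
    stdGaussian E ∗ (stdGaussian E).map (√(k : ℝ) • ·) =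
      (stdGaussian E).map (√((k + 1 : ℕ) : ℝ) • ·) := by
  have (r : ℝ) : IsProbabilityMeasure ((stdGaussian E).map (r • ·)) :=
    Measure.isProbabilityMeasure_map (by fun_prop)
  refine Measure.ext_of_charFun (funext fun t => ?_)
  rw [charFun_conv, charFun_map_smul, charFun_map_smul, charFun_stdGaussian, charFun_stdGaussian,
    charFun_stdGaussian, ← Complex.exp_add]
  congr 1
  simp only [norm_smul, Real.norm_eq_abs, abs_of_nonneg (Real.sqrt_nonneg _), mul_pow,
    ← Complex.ofReal_pow, Complex.ofReal_mul, Real.sq_sqrt (Nat.cast_nonneg' _)]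
  push_cast
  ring

/-- The central limit theorem with a rate for sums of independent vectors with the first two
moments of the standard Gaussian law, by replacement of one summand after the other. -/
theorem IsTestFunction.abs_integral_sum_sub_le (hh : IsTestFunction h)
    {Ω : Type*} [MeasurableSpace Ω] {P : Measure Ω} [IsProbabilityMeasure P] {n : ℕ}
    {U : Fin n → Ω → EuclideanSpace ℝ (Fin d)} {μ : Measure (EuclideanSpace ℝ (Fin d))}
    [IsProbabilityMeasure μ] (hU : ∀ i, HasLaw (U i) μ P) (hind : iIndepFun U P)
    (iμ : Integrable id μ) {c ε : ℝ}
    (hε : ∀ x, |∫ a, h (x + c • a) ∂μ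
      - ∫ a, h (x + c • a) ∂(stdGaussian (EuclideanSpace ℝ (Fin d)))| ≤ ε)
    (s : Finset (Fin n)) (x : EuclideanSpace ℝ (Fin d)) :
    |∫ ω, h (x + c • ∑ i ∈ s, U i ω) ∂P
      - ∫ a, h (x + c • √(s.card : ℝ) • a) ∂(stdGaussian (EuclideanSpace ℝ (Fin d)))|
      ≤ s.card * ε := by
  have meas : ∀ s : Finset (Fin n), AEMeasurable (∑ i ∈ s, U i) P := fun s =>
    Finset.aemeasurable_sum _ fun i _ => (hU i).aemeasurable
  have hp : ∀ s : Finset (Fin n), IsProbabilityMeasure (P.map (∑ i ∈ s, U i)) := fun s =>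
    Measure.isProbabilityMeasure_map (meas s)
  have hg : ∀ r : ℝ, IsProbabilityMeasure
      ((stdGaussian (EuclideanSpace ℝ (Fin d))).map (r • ·)) := fun r =>
    Measure.isProbabilityMeasure_map (by fun_prop)
  have iU : ∀ i, Integrable (U i) P := fun i => by
    have := iμ
    rw [← (hU i).map_eq, integrable_map_measure aestronglyMeasurable_id (hU i).aemeasurable] at this
    exact this
  have iS : ∀ s : Finset (Fin n), Integrable id (P.map (∑ i ∈ s, U i)) := fun s => by
    rw [integrable_map_measure aestronglyMeasurable_id (meas s)]
    exact integrable_finsetSum' _ fun i _ => iU i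
  have iG : ∀ r : ℝ, Integrable id
      ((stdGaussian (EuclideanSpace ℝ (Fin d))).map (r • ·)) := fun r => by
    rw [integrable_map_measure aestronglyMeasurable_id (by fun_prop)]
    exact IsGaussian.integrable_id.smul r
  have cont : ∀ x, Continuous fun a => h (x + c • a) := fun x =>
    hh.differentiable.continuous.comp (by fun_prop)
  -- Stated for laws rather than random vectors, so that no Gaussian vectors need to be constructed
  -- on `Ω`, and for all `x`, as the convolution step requires.
  have main : ∀ x, |∫ a, h (x + c • a) ∂(P.map (∑ i ∈ s, U i))
      - ∫ a, h (x + c • a) ∂((stdGaussian (EuclideanSpace ℝ (Fin d))).map (√(s.card : ℝ) • ·))|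
      ≤ s.card * ε := by
    induction s using Finset.induction_on with
    | empty =>
      intro x
      rw [integral_map (by fun_prop) (cont x).aestronglyMeasurable,
        integral_map (by fun_prop) (cont x).aestronglyMeasurable]
      simp
    | insert i s hi ih =>
      intro x
      rw [Finset.sum_insert hi, Finset.card_insert_of_notMem hi, ← stdGaussian_map_sqrt_conv,
        (hind.indepFun_finsetSum_of_notMem₀ (fun i => (hU i).aemeasurable)
          hi).symm.map_add_eq_map_conv_map₀ (hU i).aemeasurable (meas s), (hU i).map_eq]
      refine (hh.abs_integral_conv_sub_le iμ IsGaussian.integrable_id (iS s) (iG _) hε ih x).trans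
        (le_of_eq ?_)
      push_cast
      ring
  have := main x
  rw [integral_map (meas s) (cont x).aestronglyMeasurable,
    integral_map (by fun_prop) (cont x).aestronglyMeasurable] at this
  simpa only [Finset.sum_apply] using this

end Lindeberg

/-! ### Moments of the one-dimensional Gaussian law. -/

theorem integrable_pow_gaussianReal (m : ℝ) (v : NNReal) (k : ℕ) :
    Integrable (fun x : ℝ => x ^ k) (gaussianReal m v) := by
  have h := (memLp_id_gaussianReal (μ := m) (v := v) k).integrable_norm_pow'
  refine (integrable_norm_iff (by fun_prop)).1 (h.congr ?_)
  exact Filter.Eventually.of_forall fun x => by simp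

/-- Integration by parts: the density satisfies `φ' = -x φ`, so the integral of `(φ x^(k+1))'`,
which vanishes, is the difference of the two sides. -/
theorem integral_pow_add_two_gaussianReal (k : ℕ) :
    ∫ x, x ^ (k + 2) ∂(gaussianReal 0 1) = (k + 1) * ∫ x, x ^ k ∂(gaussianReal 0 1) := by
  have hd : ∀ x, HasDerivAt (fun x => gaussianPDFReal 0 1 x * x ^ (k + 1))
      ((k + 1) * (gaussianPDFReal 0 1 x * x ^ k) - gaussianPDFReal 0 1 x * x ^ (k + 2)) x := by
    intro x
    have h₁ : HasDerivAt (gaussianPDFReal 0 1) (-x * gaussianPDFReal 0 1 x) x := by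
      have h₂ : HasDerivAt (fun x : ℝ => -(x - 0) ^ 2 / (2 * ((1 : NNReal) : ℝ))) (-x) x :=
        ((((hasDerivAt_id x).sub_const 0).pow 2).neg.div_const _).congr_deriv (by simp; ring)
      rw [gaussianPDFReal_def]
      exact (h₂.exp.const_mul _).congr_deriv (by ring)
    exact (h₁.mul (hasDerivAt_pow (k + 1) x)).congr_deriv (by push_cast; ring_nf)
  have hi : ∀ j : ℕ, Integrable (fun x : ℝ => gaussianPDFReal 0 1 x * x ^ j) := by
    intro j
    have := integrable_pow_gaussianReal 0 1 j
    rw [gaussianReal_of_var_ne_zero 0 one_ne_zero,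
      integrable_withDensity_iff_integrable_smul' (measurable_gaussianPDF 0 1)
        (Filter.Eventually.of_forall fun x => gaussianPDF_lt_top)] at this
    simpa [toReal_gaussianPDF] using this
  have := integral_eq_zero_of_hasDerivAt_of_integrable hd (((hi k).const_mul _).sub (hi _)) (hi _)
  rw [integral_sub ((hi k).const_mul _) (hi _), integral_const_mul] at this
  simp only [integral_gaussianReal_eq_integral_smul one_ne_zero, smul_eq_mul]
  linarith

theorem integral_pow_gaussianReal :
    ∫ x, x ∂(gaussianReal 0 1) = 0 ∧ ∫ x, x ^ 2 ∂(gaussianReal 0 1) = 1 ∧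
    ∫ x, x ^ 3 ∂(gaussianReal 0 1) = 0 ∧ ∫ x, x ^ 4 ∂(gaussianReal 0 1) = 3 ∧
    ∫ x, x ^ 6 ∂(gaussianReal 0 1) = 15 := by
  have h₁ : ∫ x, x ∂(gaussianReal 0 1) = 0 := integral_id_gaussianReal
  have h₂ : ∫ x, x ^ 2 ∂(gaussianReal 0 1) = 1 := by
    simpa using integral_pow_add_two_gaussianReal 0
  have h₃ := integral_pow_add_two_gaussianReal 1
  have h₄ := integral_pow_add_two_gaussianReal 2
  have h₆ := integral_pow_add_two_gaussianReal 4
  norm_num [h₁, h₂] at h₃ h₄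
  norm_num [h₄] at h₆
  exact ⟨h₁, h₂, h₃, h₄, h₆⟩

/-- The difference of the sides is `3 (|a| + |b|) (|a| - |b|)²`. -/
theorem abs_add_abs_pow_three_le (a b : ℝ) :
    (|a| + |b|) ^ 3 ≤ 4 * (|a| ^ 3 + |b| ^ 3) := by
  nlinarith [abs_nonneg a, abs_nonneg b, mul_nonneg (add_nonneg (abs_nonneg a) (abs_nonneg b))
    (sq_nonneg (|a| - |b|))]

/-- Trades an odd absolute moment for even moments, which are known exactly. -/
theorem abs_pow_three_le (a : ℝ) : |a| ^ 3 ≤ (a ^ 2 + a ^ 4) / 2 := by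
  have h₂ := sq_abs a
  have h₄ : |a| ^ 4 = a ^ 4 := by rw [show 4 = 2 * 2 from rfl, pow_mul, pow_mul, h₂]
  rw [← h₂, ← h₄]
  nlinarith [mul_nonneg (sq_nonneg |a|) (sq_nonneg (|a| - 1))]

/-! ### Moments of the score vector. -/

/-- The standardized vector of the first two powers of one standardized observation. -/
noncomputable def scoreVector (y : ℝ) : EuclideanSpace ℝ (Fin 2) := !₂[y, (y ^ 2 - 1) / √2]

@[fun_prop]
theorem continuous_scoreVector : Continuous scoreVector := by
  unfold scoreVector
  refine (PiLp.continuous_toLp 2 _).comp (continuous_pi fun i => ?_)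
  fin_cases i
  · exact continuous_id
  · simp only [Fin.mk_one, Matrix.cons_val_one, Matrix.cons_val_fin_one]
    fun_prop

/-- Here `|y² - 1| ≤ max(y², 1)`, and `(√2)³ = 2√2 ≥ 2`. -/
theorem abs_scoreVector_pow_three_le (y : ℝ) :
    |(y ^ 2 - 1) / √2| ^ 3 ≤ (y ^ 6 + 1) / 2 := by
  have h2 : (1 : ℝ) ≤ √2 := Real.one_le_sqrt.2 (by norm_num)
  have hs : √2 ^ 2 = (2 : ℝ) := Real.sq_sqrt (by norm_num)
  have h3 : |y ^ 2 - 1| ^ 3 ≤ y ^ 6 + 1 := by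
    rcases abs_cases (y ^ 2 - 1) with ⟨h, h'⟩ | ⟨h, h'⟩ <;> rw [h]
    · nlinarith [sq_nonneg y, mul_nonneg (sq_nonneg y) h']
    · nlinarith [sq_nonneg y, mul_nonneg (sq_nonneg y) (neg_nonneg.2 h'.le),
        pow_nonneg (sq_nonneg y) 3]
  rw [abs_div, abs_of_nonneg (Real.sqrt_nonneg 2), div_pow, show √2 ^ 3 = 2 * √2 by
    rw [pow_succ, hs]]
  exact div_le_div₀ (by positivity) h3 (by norm_num) (by linarith)

theorem memLp_three_scoreVector (i : Fin 2) :
    MemLp (fun a : EuclideanSpace ℝ (Fin 2) => a i) 3 ((gaussianReal 0 1).map scoreVector) := by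
  rw [memLp_map_measure_iff (by fun_prop) (by fun_prop)]
  have key : ∀ f : ℝ → ℝ, Continuous f → (∀ y, |f y| ^ 3 ≤ y ^ 6 + y ^ 4 + y ^ 2 + 1) →
      MemLp f 3 (gaussianReal 0 1) := by
    intro f hf hb
    rw [← integrable_norm_rpow_iff hf.aestronglyMeasurable (by norm_num) (by norm_num)]
    refine Integrable.mono' ((((integrable_pow_gaussianReal 0 1 6).add
      (integrable_pow_gaussianReal 0 1 4)).add (integrable_pow_gaussianReal 0 1 2)).add
      (integrable_const 1)) ?_ (Filter.Eventually.of_forall fun y => ?_)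
    · exact (hf.norm.rpow_const fun _ => Or.inr (by norm_num)).aestronglyMeasurable
    have := hb y
    simpa using this
  fin_cases i
  · refine key (fun y => y) continuous_id fun y => ?_
    have := abs_pow_three_le y
    nlinarith [sq_nonneg (y ^ 3), sq_nonneg (y ^ 2), sq_nonneg y]
  · refine key (fun y => (y ^ 2 - 1) / √2) (by fun_prop) fun y => ?_
    have := abs_scoreVector_pow_three_le y
    nlinarith [sq_nonneg (y ^ 3), sq_nonneg (y ^ 2), sq_nonneg y]

theorem integral_scoreVector (i : Fin 2) :
    ∫ a : EuclideanSpace ℝ (Fin 2), a i ∂((gaussianReal 0 1).map scoreVector) = 0 := by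
  obtain ⟨m₁, m₂, -, -, -⟩ := integral_pow_gaussianReal
  rw [integral_map (by fun_prop) (by fun_prop)]
  fin_cases i
  · exact m₁
  · change ∫ y, (y ^ 2 - 1) / √2 ∂(gaussianReal 0 1) = 0
    rw [integral_div, integral_sub (integrable_pow_gaussianReal 0 1 2) (integrable_const _), m₂]
    simp

/-- The cross terms contain only odd moments; the second variance is `(3 - 2 + 1)/2 = 1`. -/
theorem integral_scoreVector_mul (i j : Fin 2) :
    ∫ a : EuclideanSpace ℝ (Fin 2), a i * a j ∂((gaussianReal 0 1).map scoreVector)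
      = if i = j then 1 else 0 := by
  obtain ⟨m₁, m₂, m₃, m₄, -⟩ := integral_pow_gaussianReal
  have i₁ : Integrable (fun y : ℝ => y) (gaussianReal 0 1) := by
    simpa using integrable_pow_gaussianReal 0 1 1
  have c : ∫ y, y * ((y ^ 2 - 1) / √2) ∂(gaussianReal 0 1) = 0 := by
    simp_rw [show ∀ y : ℝ, y * ((y ^ 2 - 1) / √2) = (y ^ 3 - y) / √2 from fun y => by ring]
    rw [integral_div, integral_sub (integrable_pow_gaussianReal 0 1 3) i₁, m₃, m₁]
    simp
  rw [integral_map (by fun_prop) (by fun_prop)]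
  fin_cases i <;> fin_cases j
  · change ∫ y, y * y ∂(gaussianReal 0 1) = 1
    simpa [sq] using m₂
  · exact c
  · change ∫ y, (y ^ 2 - 1) / √2 * y ∂(gaussianReal 0 1) = 0
    simpa only [mul_comm] using c
  · change ∫ y, (y ^ 2 - 1) / √2 * ((y ^ 2 - 1) / √2) ∂(gaussianReal 0 1) = 1
    have hs : √2 * √2 = (2 : ℝ) := Real.mul_self_sqrt (by norm_num)
    simp_rw [show ∀ y : ℝ, (y ^ 2 - 1) / √2 * ((y ^ 2 - 1) / √2) = (y ^ 4 - 2 * y ^ 2 + 1) / 2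
      from fun y => by rw [div_mul_div_comm, hs]; ring]
    have i₄₂ : Integrable (fun y : ℝ => y ^ 4 - 2 * y ^ 2) (gaussianReal 0 1) :=
      (integrable_pow_gaussianReal 0 1 4).sub ((integrable_pow_gaussianReal 0 1 2).const_mul 2)
    rw [integral_div, integral_add i₄₂ (integrable_const _),
      integral_sub (integrable_pow_gaussianReal 0 1 4)
      ((integrable_pow_gaussianReal 0 1 2).const_mul 2), integral_const_mul, m₂, m₄]
    norm_num

theorem integral_abs_scoreVector_pow_three_le :
    ∫ a : EuclideanSpace ℝ (Fin 2), (∑ i, |a i|) ^ 3 ∂((gaussianReal 0 1).map scoreVector)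
      ≤ 40 := by
  obtain ⟨-, m₂, -, m₄, m₆⟩ := integral_pow_gaussianReal
  have j : ∀ k, Integrable (fun y : ℝ => y ^ k) (gaussianReal 0 1) :=
    integrable_pow_gaussianReal 0 1
  rw [integral_map (by fun_prop) (by fun_prop)]
  calc ∫ y, (∑ i, |scoreVector y i|) ^ 3 ∂(gaussianReal 0 1)
      -- The moments 1, 3, 15 of orders 2, 4, 6 give `2(1 + 3) + 2(15 + 1) = 40`.
      ≤ ∫ y, (2 * (y ^ 2 + y ^ 4) + 2 * (y ^ 6 + 1)) ∂(gaussianReal 0 1) := by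
        refine integral_mono_of_nonneg (Filter.Eventually.of_forall fun y => by positivity)
          ((((j 2).fun_add (j 4)).const_mul 2).add
            (((j 6).fun_add (integrable_const 1)).const_mul 2))
          (Filter.Eventually.of_forall fun y => ?_)
        simp only [Fin.sum_univ_two]
        have h₁ := abs_add_abs_pow_three_le y ((y ^ 2 - 1) / √2)
        have h₂ := abs_pow_three_le y
        have h₃ := abs_scoreVector_pow_three_le y
        change (|y| + |(y ^ 2 - 1) / √2|) ^ 3 ≤ 2 * (y ^ 2 + y ^ 4) + 2 * (y ^ 6 + 1)
        linarith
    _ = 40 := by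
        rw [integral_add (((j 2).fun_add (j 4)).const_mul 2)
          (((j 6).fun_add (integrable_const 1)).const_mul 2), integral_const_mul,
          integral_const_mul, integral_add (j 2) (j 4), integral_add (j 6) (integrable_const 1), m₂, m₄, m₆]
        norm_num

/-! ### Moments of the standard Gaussian vector. -/

theorem map_eval_stdGaussian {d : ℕ} (i : Fin d) :
    (stdGaussian (EuclideanSpace ℝ (Fin d))).map (fun a => a i) = gaussianReal 0 1 := by
  simpa using (measurePreserving_eval_multivariateGaussian (μ := (0 : EuclideanSpace ℝ (Fin d)))
    (Matrix.PosSemidef.one (n := Fin d) (R := ℝ)) (i := i)).map_eq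

theorem integral_eval_pow_stdGaussian {d : ℕ} (i : Fin d) (k : ℕ) :
    ∫ a, a i ^ k ∂(stdGaussian (EuclideanSpace ℝ (Fin d))) = ∫ x, x ^ k ∂(gaussianReal 0 1) := by
  rw [← map_eval_stdGaussian i, integral_map (by fun_prop) (by fun_prop)]

theorem integrable_eval_pow_stdGaussian {d : ℕ} (i : Fin d) (k : ℕ) :
    Integrable (fun a => a i ^ k) (stdGaussian (EuclideanSpace ℝ (Fin d))) := by
  have := integrable_pow_gaussianReal 0 1 k
  rw [← map_eval_stdGaussian i, integrable_map_measure (by fun_prop) (by fun_prop)] at this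
  exact this

theorem memLp_three_stdGaussian {d : ℕ} (i : Fin d) :
    MemLp (fun a => a i) 3 (stdGaussian (EuclideanSpace ℝ (Fin d))) := by
  have := memLp_id_gaussianReal (μ := 0) (v := 1) 3
  rw [← map_eval_stdGaussian i, memLp_map_measure_iff (by fun_prop) (by fun_prop)] at this
  exact this

theorem integral_eval_stdGaussian {d : ℕ} (i : Fin d) :
    ∫ a, a i ∂(stdGaussian (EuclideanSpace ℝ (Fin d))) = 0 := by
  simpa [integral_pow_gaussianReal.1] using integral_eval_pow_stdGaussian i 1

theorem integral_eval_mul_stdGaussian {d : ℕ} (i j : Fin d) :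
    ∫ a, a i * a j ∂(stdGaussian (EuclideanSpace ℝ (Fin d))) = if i = j then 1 else 0 := by
  have := covariance_eval_multivariateGaussian (μ := (0 : EuclideanSpace ℝ (Fin d)))
    (Matrix.PosSemidef.one (n := Fin d) (R := ℝ)) i j
  rw [multivariateGaussian_zero_one,
    covariance_eq_sub ((memLp_three_stdGaussian i).mono_exponent (by norm_num))
      ((memLp_three_stdGaussian j).mono_exponent (by norm_num)), integral_eval_stdGaussian,
    zero_mul, sub_zero, Matrix.one_apply] at this
  exact this

theorem integral_abs_stdGaussian_pow_three_le :
    ∫ a, (∑ i, |a i|) ^ 3 ∂(stdGaussian (EuclideanSpace ℝ (Fin 2))) ≤ 16 := by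
  obtain ⟨-, m₂, -, m₄, -⟩ := integral_pow_gaussianReal
  have j := integrable_eval_pow_stdGaussian (d := 2)
  calc ∫ a, (∑ i, |a i|) ^ 3 ∂(stdGaussian (EuclideanSpace ℝ (Fin 2)))
      ≤ ∫ a, (2 * (a 0 ^ 2 + a 0 ^ 4) + 2 * (a 1 ^ 2 + a 1 ^ 4))
        ∂(stdGaussian (EuclideanSpace ℝ (Fin 2))) := by
        refine integral_mono_of_nonneg (Filter.Eventually.of_forall fun y => by positivity)
          ((((j 0 2).fun_add (j 0 4)).const_mul 2).add (((j 1 2).fun_add (j 1 4)).const_mul 2))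
          (Filter.Eventually.of_forall fun a => ?_)
        simp only [Fin.sum_univ_two]
        linarith [abs_add_abs_pow_three_le (a 0) (a 1), abs_pow_three_le (a 0),
          abs_pow_three_le (a 1)]
    _ = 16 := by
        rw [integral_add (((j 0 2).fun_add (j 0 4)).const_mul 2)
          (((j 1 2).fun_add (j 1 4)).const_mul 2), integral_const_mul, integral_const_mul,
          integral_add (j 0 2) (j 0 4), integral_add (j 1 2) (j 1 4)]
        simp only [integral_eval_pow_stdGaussian, m₂, m₄]
        norm_num

theorem integrable_id_scoreVector : Integrable id ((gaussianReal 0 1).map scoreVector) := by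
  have : IsProbabilityMeasure ((gaussianReal 0 1).map scoreVector) :=
    Measure.isProbabilityMeasure_map (by fun_prop)
  exact Integrable.of_eval_piLp fun i =>
    (memLp_three_scoreVector i).integrable (by norm_num)

/-! ### The log-density and the Fisher information. -/

theorem log_density {θ : EuclideanSpace ℝ (Fin 2)} (hθ : θ ∈ paramSpace) (x : ℝ) :
    Real.log (density θ x)
      = -(Real.log (2 * Real.pi) / 2) - Real.log (θ 1) / 2 - (x - θ 0) ^ 2 / (2 * θ 1) := by
  have h1 : 0 < θ 1 := hθ
  have hp := Real.pi_pos
  rw [density, gaussianPDFReal, Real.coe_toNNReal _ h1.le,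
    Real.log_mul (by positivity) (Real.exp_ne_zero _), Real.log_exp, Real.log_inv,
    Real.log_sqrt (by positivity), Real.log_mul (by positivity) h1.ne']
  ring

theorem density_pos {θ : EuclideanSpace ℝ (Fin 2)} (hθ : θ ∈ paramSpace) (x : ℝ) :
    0 < density θ x := by
  have h1 : 0 < θ 1 := hθ
  exact gaussianPDFReal_pos _ _ _ (by simpa using h1)

section Fisher

open Filter Topology

/-- A partial derivative of a function that agrees near the point with a function of the two
coordinates. -/
theorem partialDeriv_eq {g : EuclideanSpace ℝ (Fin 2) → ℝ} {G : ℝ → ℝ → ℝ}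
    {θ : EuclideanSpace ℝ (Fin 2)} (hθ : θ ∈ paramSpace)
    (hg : ∀ t ∈ paramSpace, g t = G (t 0) (t 1)) {i : Fin 2} {D : ℝ}
    (hD : HasDerivAt (fun s : ℝ => G (θ 0 + if i = 0 then s else 0)
      (θ 1 + if i = 1 then s else 0)) D 0) : partialDeriv i g θ = D := by
  refine HasDerivAt.deriv (hD.congr_of_eventuallyEq ?_)
  -- The formula for `g` holds only on the half-plane `paramSpace`; a short piece of the line
  -- through `θ` stays inside, which suffices for a derivative at `s = 0`.
  have hc : Continuous fun s : ℝ => (θ + s • EuclideanSpace.single i (1 : ℝ)) 1 := by fun_prop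
  have h0 : 0 < (θ + (0 : ℝ) • EuclideanSpace.single i (1 : ℝ)) 1 := by
    simpa using (show 0 < θ 1 from hθ)
  filter_upwards [hc.continuousAt.eventually (lt_mem_nhds h0)] with s hs
  rw [hg _ hs]
  fin_cases i <;> simp

theorem partialDeriv_log_density {θ : EuclideanSpace ℝ (Fin 2)} (hθ : θ ∈ paramSpace) (x : ℝ) :
    partialDeriv 0 (fun t => Real.log (density t x)) θ = (x - θ 0) / θ 1 ∧
    partialDeriv 1 (fun t => Real.log (density t x)) θ
      = -(1 / (2 * θ 1)) + (x - θ 0) ^ 2 / (2 * θ 1 ^ 2) := by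
  have h1 : θ 1 ≠ 0 := (show 0 < θ 1 from hθ).ne'
  have hi : HasDerivAt (fun s : ℝ => θ 1 + s) 1 0 := (hasDerivAt_id 0).const_add _
  constructor
  · refine partialDeriv_eq hθ (fun t ht => log_density ht x) (G := fun m v =>
      -(Real.log (2 * Real.pi) / 2) - Real.log v / 2 - (x - m) ^ 2 / (2 * v)) ?_
    simp only [if_true, if_false, add_zero, zero_ne_one]
    refine ((((((hasDerivAt_id (0 : ℝ)).const_add (θ 0)).const_sub x).fun_pow 2).div_const
      (2 * θ 1)).const_sub _).congr_deriv ?_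
    simp
    field_simp
  · refine partialDeriv_eq hθ (fun t ht => log_density ht x) (G := fun m v =>
      -(Real.log (2 * Real.pi) / 2) - Real.log v / 2 - (x - m) ^ 2 / (2 * v)) ?_
    simp only [if_true, if_false, add_zero, one_ne_zero]
    refine (((hi.log (by simpa using h1)).div_const 2).const_sub _ |>.fun_sub
      ((hasDerivAt_const (0 : ℝ) ((x - θ 0) ^ 2)).fun_div (hi.const_mul 2)
        (by simpa using h1))).congr_deriv ?_
    simp
    field_simp
    ring

theorem partialDeriv₂_log_density {θ : EuclideanSpace ℝ (Fin 2)} (hθ : θ ∈ paramSpace) (x : ℝ) :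
    partialDeriv 0 (partialDeriv 0 fun t => Real.log (density t x)) θ = -(1 / θ 1) ∧
    partialDeriv 1 (partialDeriv 0 fun t => Real.log (density t x)) θ = -((x - θ 0) / θ 1 ^ 2) ∧
    partialDeriv 0 (partialDeriv 1 fun t => Real.log (density t x)) θ = -((x - θ 0) / θ 1 ^ 2) ∧
    partialDeriv 1 (partialDeriv 1 fun t => Real.log (density t x)) θ
      = 1 / (2 * θ 1 ^ 2) - (x - θ 0) ^ 2 / θ 1 ^ 3 := by
  have h1 : θ 1 ≠ 0 := (show 0 < θ 1 from hθ).ne'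
  have hi : HasDerivAt (fun s : ℝ => θ 1 + s) 1 0 := (hasDerivAt_id 0).const_add _
  have hx : HasDerivAt (fun s : ℝ => x - (θ 0 + s)) (-1) 0 :=
    ((hasDerivAt_id (0 : ℝ)).const_add (θ 0)).const_sub x
  refine ⟨?_, ?_, ?_, ?_⟩
  · refine partialDeriv_eq hθ (fun t ht => (partialDeriv_log_density ht x).1)
      (G := fun m v => (x - m) / v) ?_
    simp only [if_true, if_false, add_zero, zero_ne_one]
    exact (hx.div_const _).congr_deriv (by ring)
  · refine partialDeriv_eq hθ (fun t ht => (partialDeriv_log_density ht x).1)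
      (G := fun m v => (x - m) / v) ?_
    simp only [if_true, if_false, add_zero, one_ne_zero]
    exact ((hasDerivAt_const (0 : ℝ) (x - θ 0)).fun_div hi (by simpa using h1)).congr_deriv
      (by simp; ring)
  · refine partialDeriv_eq hθ (fun t ht => (partialDeriv_log_density ht x).2)
      (G := fun m v => -(1 / (2 * v)) + (x - m) ^ 2 / (2 * v ^ 2)) ?_
    simp only [if_true, if_false, add_zero, zero_ne_one]
    refine (((hx.fun_pow 2).div_const (2 * θ 1 ^ 2)).const_add _).congr_deriv ?_
    simp
    field_simp
  · refine partialDeriv_eq hθ (fun t ht => (partialDeriv_log_density ht x).2)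
      (G := fun m v => -(1 / (2 * v)) + (x - m) ^ 2 / (2 * v ^ 2)) ?_
    simp only [if_true, if_false, add_zero, one_ne_zero]
    refine (((hasDerivAt_const (0 : ℝ) (1 : ℝ)).fun_div (hi.const_mul 2)
        (by simpa using h1)).fun_neg.fun_add
      ((hasDerivAt_const (0 : ℝ) ((x - θ 0) ^ 2)).fun_div ((hi.fun_pow 2).const_mul 2)
        (by simpa using h1))).congr_deriv ?_
    simp
    field_simp
    ring

theorem fisherInformation_eq {θ : EuclideanSpace ℝ (Fin 2)} (hθ : θ ∈ paramSpace) :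
    fisherInformation θ = Matrix.diagonal ![1 / θ 1, 1 / (2 * θ 1 ^ 2)] := by
  have h1 : 0 < θ 1 := hθ
  have i₁ : Integrable (fun x : ℝ => x) (law θ) := by
    simpa [law] using integrable_pow_gaussianReal (θ 0) (θ 1).toNNReal 1
  have i₂ : Integrable (fun x : ℝ => (x - θ 0) ^ 2) (law θ) := by
    refine (((integrable_pow_gaussianReal (θ 0) (θ 1).toNNReal 2).sub
      (i₁.const_mul (2 * θ 0))).add (integrable_const (θ 0 ^ 2))).congr
      (Eventually.of_forall fun x => ?_)
    simp only [Pi.add_apply, Pi.sub_apply]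
    ring
  have : IsProbabilityMeasure (law θ) := by unfold law; infer_instance
  have m₁ : ∫ x, (x - θ 0) ∂(law θ) = 0 := by
    rw [integral_sub i₁ (integrable_const _)]
    simp [law]
  have m₂ : ∫ x, (x - θ 0) ^ 2 ∂(law θ) = θ 1 := by
    have := variance_fun_id_gaussianReal (μ := θ 0) (v := (θ 1).toNNReal)
    rw [variance_eq_integral (by fun_prop), Real.coe_toNNReal _ h1.le] at this
    simpa [law] using this
  ext r s
  fin_cases r <;> fin_cases s <;>
    simp only [fisherInformation, Matrix.of_apply, Fin.zero_eta, Fin.mk_one,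
      partialDeriv₂_log_density hθ, neg_neg, Matrix.diagonal_apply_eq, Matrix.cons_val_zero,
      Matrix.cons_val_one, ne_eq, zero_ne_one, one_ne_zero, not_false_eq_true,
      Matrix.diagonal_apply_ne, integral_div, m₁, zero_div, Matrix.cons_val_fin_one]
  · simp
  -- The lower right entry is `v / v³ - 1/(2v²) = 1/(2v²)` with `v = θ 1`.
  · rw [integral_neg, integral_sub (integrable_const _) (i₂.div_const _), integral_div,
      integral_div, m₂]
    simp
    field_simp
    ring

theorem sqrt_fisherInformation {θ : EuclideanSpace ℝ (Fin 2)} {σ : ℝ} (hσ : 0 < σ)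
    (hθ : θ 1 = σ ^ 2) :
    CFC.sqrt (fisherInformation θ) = Matrix.diagonal ![1 / σ, 1 / (√2 * σ ^ 2)] := by
  have hθ' : θ ∈ paramSpace := by simp only [paramSpace, Set.mem_ofPred_eq, hθ]; positivity
  refine CFC.sqrt_unique ?_ ?_
  · rw [fisherInformation_eq hθ', hθ, Matrix.diagonal_mul_diagonal]
    congr 1
    have hs : √2 ^ 2 = (2 : ℝ) := Real.sq_sqrt (by norm_num)
    ext i
    fin_cases i
    · simp; ring
    · simp only [Fin.mk_one, Matrix.cons_val_one, Matrix.cons_val_fin_one]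
      field_simp
      rw [hs]
  · refine Matrix.nonneg_iff_posSemidef.2 (Matrix.PosSemidef.diagonal fun i => ?_)
    fin_cases i <;> simp <;> positivity

end Fisher

/-! ### The maximum likelihood estimate. -/

section MaximumLikelihood

variable {n : ℕ}

theorem estimator_zero (x : Fin n → ℝ) : estimator x 0 = sampleMean x := rfl

theorem estimator_one (x : Fin n → ℝ) :
    estimator x 1 = (∑ i, (x i - sampleMean x) ^ 2) / n := rfl

/-- The bias–variance decomposition; through it the likelihood depends on the data only via
`estimator x`. -/
theorem sum_sub_sq (hn : n ≠ 0) (x : Fin n → ℝ) (m : ℝ) :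
    ∑ i, (x i - m) ^ 2 = n * (estimator x 1 + (estimator x 0 - m) ^ 2) := by
  have hn' : (n : ℝ) ≠ 0 := Nat.cast_ne_zero.2 hn
  have hs : ∑ i, x i = n * sampleMean x := by rw [sampleMean]; field_simp
  have : ∀ i, (x i - m) ^ 2 = (x i - sampleMean x) ^ 2 + 2 * (sampleMean x - m) * x i
      + (m ^ 2 - sampleMean x ^ 2) := fun i => by ring
  rw [Finset.sum_congr rfl fun i _ => this i, Finset.sum_add_distrib, Finset.sum_add_distrib,
    ← Finset.mul_sum, hs, Finset.sum_const, Finset.card_univ, Fintype.card_fin, nsmul_eq_mul,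
    estimator_zero, estimator_one]
  field_simp
  ring

theorem log_likelihood (hn : n ≠ 0) (x : Fin n → ℝ) {θ : EuclideanSpace ℝ (Fin 2)}
    (hθ : θ ∈ paramSpace) :
    Real.log (likelihood x θ) = n * (-(Real.log (2 * Real.pi) / 2) - Real.log (θ 1) / 2
      - (estimator x 1 + (estimator x 0 - θ 0) ^ 2) / (2 * θ 1)) := by
  rw [likelihood, Real.log_prod fun i _ => (density_pos hθ (x i)).ne',
    Finset.sum_congr rfl fun i _ => log_density hθ (x i), Finset.sum_sub_distrib,
    ← Finset.sum_div, sum_sub_sq hn]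
  simp
  ring

theorem likelihood_pos (x : Fin n → ℝ) {θ : EuclideanSpace ℝ (Fin 2)} (hθ : θ ∈ paramSpace) :
    0 < likelihood x θ :=
  Finset.prod_pos fun i _ => density_pos hθ (x i)

theorem likelihood_lt (hn : n ≠ 0) {x : Fin n → ℝ} (hx : 0 < estimator x 1)
    {θ : EuclideanSpace ℝ (Fin 2)} (hθ : θ ∈ paramSpace) (hne : θ ≠ estimator x) :
    likelihood x θ < likelihood x (estimator x) := by
  have h1 : 0 < θ 1 := hθ
  have hn' : (0 : ℝ) < n := by positivity
  rw [← Real.log_lt_log_iff (likelihood_pos x hθ) (likelihood_pos x hx),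
    log_likelihood hn x hθ, log_likelihood hn x hx]
  refine mul_lt_mul_of_pos_left ?_ hn'
  set s := estimator x 1
  set d := estimator x 0 - θ 0 with hd
  have hl : Real.log (s / θ 1) = Real.log s - Real.log (θ 1) := Real.log_div hx.ne' h1.ne'
  have hq : (s + d ^ 2) / (2 * θ 1) = s / θ 1 / 2 + d ^ 2 / (2 * θ 1) := by field_simp
  have hself : (s + (estimator x 0 - estimator x 0) ^ 2) / (2 * s) = 1 / 2 := by
    rw [sub_self]; field_simp; ring
  rw [hq, hself]
  have hd0 : 0 ≤ d ^ 2 / (2 * θ 1) := by positivity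
  -- With `r = s / θ 1` the gap is governed by `r - 1 - log r`, strictly positive unless `r = 1`. In
  -- that case the means must differ, and the term in `d²` gives strictness.
  by_cases hs : s = θ 1
  · have hdne : d ≠ 0 := fun h => hne <| by
      ext i
      fin_cases i
      · exact (sub_eq_zero.1 (hd ▸ h)).symm
      · exact hs.symm
    have : 0 < d ^ 2 / (2 * θ 1) := by positivity
    rw [hs, div_self h1.ne']
    linarith
  · have := Real.log_lt_sub_one_of_pos (div_pos hx h1)
      (fun h => hs ((div_eq_one_iff_eq h1.ne').1 h))
    linarith

theorem isMLE_iff (hn : n ≠ 0) {x : Fin n → ℝ} (hx : 0 < estimator x 1)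
    (t : EuclideanSpace ℝ (Fin 2)) : IsMLE x t ↔ t = estimator x := by
  constructor
  · rintro ⟨ht, hmax⟩
    by_contra hne
    exact (likelihood_lt hn hx ht hne).not_ge (hmax hx)
  · rintro rfl
    refine ⟨hx, fun θ hθ => ?_⟩
    by_cases hne : θ = estimator x
    · exact (congrArg (likelihood x) hne).le
    · exact (likelihood_lt hn hx hθ hne).le

theorem estimator_one_pos {x : Fin n → ℝ} {i j : Fin n} (hij : x i ≠ x j) :
    0 < estimator x 1 := by
  have hn : 0 < n := i.pos
  rw [estimator_one]
  refine div_pos ?_ (Nat.cast_pos.2 hn)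
  refine (Finset.sum_nonneg fun k _ => sq_nonneg _).lt_of_ne' fun h => hij ?_
  rw [Finset.sum_eq_zero_iff_of_nonneg fun k _ => sq_nonneg _] at h
  have e := fun k => sub_eq_zero.1 (pow_eq_zero_iff two_ne_zero |>.1 (h k (Finset.mem_univ k)))
  rw [e i, e j]

theorem ae_ne_of_indepFun {Ω : Type*} [MeasurableSpace Ω] {P : Measure Ω} [IsProbabilityMeasure P]
    {X Y : Ω → ℝ} {ν : Measure ℝ} [IsProbabilityMeasure ν] [NullSingletonClass ν]
    (hX : HasLaw X ν P) (hY : HasLaw Y ν P) (h : IndepFun X Y P) : ∀ᵐ ω ∂P, X ω ≠ Y ω := by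
  have hm : MeasurableSet {p : ℝ × ℝ | p.1 ≠ p.2} :=
    (measurableSet_eq_fun measurable_fst measurable_snd).compl
  -- The diagonal is a null set by Fubini, since each of its fibres is a single point.
  have hp : ∀ᵐ p ∂(ν.prod ν), p.1 ≠ p.2 := by
    rw [Measure.ae_prod_iff_ae_ae hm]
    refine Filter.Eventually.of_forall fun a => ?_
    simp [ae_iff]
  rw [indepFun_iff_map_prod_eq_prod_map_map hX.aemeasurable hY.aemeasurable, hX.map_eq,
    hY.map_eq] at h
  rw [← h, ae_map_iff (hX.aemeasurable.prodMk hY.aemeasurable) hm] at hp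
  exact hp

end MaximumLikelihood

/-! ### Normal approximation of the standardized estimator. -/

theorem standardize_estimator {n : ℕ} (hn : n ≠ 0) {θ₀ : EuclideanSpace ℝ (Fin 2)} {μ σ : ℝ}
    (hσ : 0 < σ) (hθ₀ : θ₀ = !₂[μ, σ ^ 2]) {x y : Fin n → ℝ} (hy : ∀ i, x i = μ + σ * y i) :
    standardize n θ₀ (estimator x) = (√(n : ℝ))⁻¹ • ∑ i, scoreVector (y i)
      + EuclideanSpace.single 1 (-(((√(n : ℝ))⁻¹ * ∑ i, y i) ^ 2 / (√2 * √n))) := by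
  have hr : 0 < √(n : ℝ) := Real.sqrt_pos.2 (by positivity)
  have h2 : 0 < √(2 : ℝ) := Real.sqrt_pos.2 (by positivity)
  have hn' : (n : ℝ) = √n ^ 2 := (Real.sq_sqrt n.cast_nonneg).symm
  have hθ₁ : θ₀ 1 = σ ^ 2 := by simp [hθ₀]
  have e₀ : estimator x 0 = μ + σ * ((∑ i, y i) / n) := by
    rw [estimator_zero, sampleMean, Finset.sum_congr rfl fun i _ => hy i, Finset.sum_add_distrib,
      ← Finset.mul_sum]
    simp
    field_simp
  -- The sample variance is the mean square about `μ` minus the squared deviation of the sample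
  -- mean. The former yields the linear score, the latter the quadratic correction.
  have e₁ : estimator x 1 = σ ^ 2 * ((∑ i, y i ^ 2) / n - ((∑ i, y i) / n) ^ 2) := by
    have h := sum_sub_sq hn x μ
    rw [e₀, Finset.sum_congr rfl fun i _ => show (x i - μ) ^ 2 = σ ^ 2 * y i ^ 2 by
      rw [hy]; ring, ← Finset.mul_sum] at h
    field_simp
    field_simp at h
    linarith
  rw [standardize, sqrt_fisherInformation hσ hθ₁]
  generalize estimator x = t at e₀ e₁
  have ht : t - θ₀ = WithLp.toLp 2 ![t 0 - μ, t 1 - σ ^ 2] := by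
    ext i
    fin_cases i <;> simp [hθ₀]
  rw [ht, Matrix.toEuclideanCLM_toLp, e₀, e₁]
  generalize hr' : √(n : ℝ) = r at *
  ext i
  fin_cases i
  · simp [scoreVector, hn']
    field_simp
  · simp [scoreVector, hn', ← Finset.sum_div]
    field_simp
    ring

/-- The normal approximation of the standardized maximum likelihood estimator. -/
theorem abs_integral_standardize_estimator_sub_le {Ω : Type*} [MeasurableSpace Ω]
    {P : Measure Ω} [IsProbabilityMeasure P] {n : ℕ} (hn : n ≠ 0) {μ σ : ℝ} (hσ : 0 < σ)
    {θ₀ : EuclideanSpace ℝ (Fin 2)} (hθ₀ : θ₀ = !₂[μ, σ ^ 2])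
    {X : Fin n → Ω → ℝ} (hlaw : ∀ i, HasLaw (X i) (law θ₀) P) (hindep : iIndepFun X P)
    {h : EuclideanSpace ℝ (Fin 2) → ℝ} (hh : IsTestFunction h) :
    Integrable (fun ω => h (standardize n θ₀ (estimator fun i => X i ω))) P ∧
    |∫ ω, h (standardize n θ₀ (estimator fun i => X i ω)) ∂P
      - ∫ z, h z ∂(stdGaussian (EuclideanSpace ℝ (Fin 2)))|
      ≤ 10 / √n * (supNorm₃ h).toReal + 1 / √n * (supNorm₁ h).toReal := by
  have hn0 : (n : ℝ) ≠ 0 := Nat.cast_ne_zero.2 hn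
  have hr : 0 < √(n : ℝ) := Real.sqrt_pos.2 (by positivity)
  have hn' : √(n : ℝ) ^ 2 = n := Real.sq_sqrt n.cast_nonneg
  have h2 : (1 : ℝ) ≤ √2 := Real.one_le_sqrt.2 (by norm_num)
  set Y : Fin n → Ω → ℝ := fun i ω => (X i ω - μ) / σ with hY
  have lawY : ∀ i, HasLaw (Y i) (gaussianReal 0 1) P := fun i => by
    have := gaussianReal_div_const (gaussianReal_sub_const (hlaw i) μ) σ
    convert this using 1
    rw [hθ₀]
    congr 1
    · simp
    · ext
      simp [Real.coe_toNNReal _ (sq_nonneg σ), hσ.ne']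
  have indY : iIndepFun Y P := hindep.comp (fun _ x => (x - μ) / σ) fun _ => by fun_prop
  set U : Fin n → Ω → EuclideanSpace ℝ (Fin 2) := fun i ω => scoreVector (Y i ω) with hU
  have lawU : ∀ i, HasLaw (U i) ((gaussianReal 0 1).map scoreVector) P := fun i =>
    HasLaw.fun_comp ⟨by fun_prop, rfl⟩ (lawY i)
  have indU : iIndepFun U P := indY.comp (fun _ => scoreVector) fun _ => by fun_prop
  have hp : IsProbabilityMeasure ((gaussianReal 0 1).map scoreVector) :=
    Measure.isProbabilityMeasure_map (by fun_prop)
  set W : Ω → EuclideanSpace ℝ (Fin 2) := fun ω => (√(n : ℝ))⁻¹ • ∑ i, U i ω with hW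
  set R : Ω → ℝ := fun ω => (√(n : ℝ))⁻¹ * ∑ i, Y i ω with hR
  have hT : ∀ ω, standardize n θ₀ (estimator fun i => X i ω)
      = W ω + EuclideanSpace.single 1 (-(R ω ^ 2 / (√2 * √n))) := fun ω =>
    standardize_estimator hn hσ hθ₀ fun i => by simp only [hY]; field_simp; ring
  have memY : ∀ i, MemLp (Y i) 2 P := fun i => by
    have := memLp_id_gaussianReal (μ := 0) (v := 1) 2
    rw [← (lawY i).map_eq, memLp_map_measure_iff (by fun_prop) (lawY i).aemeasurable] at this
    exact this
  have memS : MemLp (fun ω => ∑ i, Y i ω) 2 P := memLp_finsetSum _ fun i _ => memY i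
  have iR : Integrable (fun ω => R ω ^ 2) P := (memS.const_mul _).integrable_sq
  have mR : ∫ ω, R ω ^ 2 ∂P = 1 := by
    have mean : ∫ ω, ∑ i, Y i ω ∂P = 0 := by
      rw [integral_finsetSum _ fun i _ => (memY i).integrable (by norm_num)]
      refine Finset.sum_eq_zero fun i _ => ?_
      rw [(lawY i).integral_eq, integral_id_gaussianReal]
    have var := IndepFun.variance_sum (s := Finset.univ) (fun i _ => memY i)
      fun i _ j _ hij => indY.indepFun hij
    rw [Finset.sum_congr rfl fun i _ => (lawY i).variance_eq.trans variance_id_gaussianReal,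
      variance_eq_integral (by fun_prop)] at var
    simp only [Finset.sum_apply, mean, sub_zero] at var
    simp_rw [hR, mul_pow]
    rw [integral_const_mul, var, inv_pow, hn']
    simp [hn0]
  have iU : ∀ i, Integrable (U i) P := fun i => by
    have := integrable_id_scoreVector
    rw [← (lawU i).map_eq,
      integrable_map_measure aestronglyMeasurable_id (lawU i).aemeasurable] at this
    exact this
  have iW : Integrable W P :=
    (integrable_finsetSum Finset.univ fun i _ => iU i).smul (√(n : ℝ))⁻¹
  have iT : Integrable (fun ω => W ω + EuclideanSpace.single 1 (-(R ω ^ 2 / (√2 * √n)))) P := by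
    refine iW.add (Integrable.of_eval_piLp fun i => ?_)
    fin_cases i
    · simp
    · simpa using (iR.div_const _)
  have ihT := hh.integrable_comp iT
  have ihW := hh.integrable_comp iW
  simp_rw [hT]
  refine ⟨ihT, ?_⟩
  -- The factor `1/√2` of the correction is bounded by 1, leaving `‖h‖₁ E[R²] / √n`.
  have delta : |∫ ω, h (W ω + EuclideanSpace.single 1 (-(R ω ^ 2 / (√2 * √n)))) ∂P
      - ∫ ω, h (W ω) ∂P| ≤ 1 / √n * (supNorm₁ h).toReal := by
    rw [← integral_sub ihT ihW]
    have : ∀ ω, ‖h (W ω + EuclideanSpace.single 1 (-(R ω ^ 2 / (√2 * √n)))) - h (W ω)‖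
        ≤ (supNorm₁ h).toReal / √n * R ω ^ 2 := fun ω => by
      refine (hh.abs_add_sub_le _ _).trans ?_
      rw [Fin.sum_univ_two]
      simp only [PiLp.single_apply, zero_ne_one, if_false, if_true, abs_zero, zero_add, abs_neg]
      rw [abs_of_nonneg (by positivity), div_mul_eq_mul_div, mul_div_assoc]
      refine mul_le_mul_of_nonneg_left ?_ ENNReal.toReal_nonneg
      exact div_le_div_of_nonneg_left (sq_nonneg _) hr (le_mul_of_one_le_left hr.le h2)
    refine (norm_integral_le_of_norm_le (iR.const_mul _) (Filter.Eventually.of_forall this)).trans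
      (le_of_eq ?_)
    rw [integral_const_mul, mR]
    ring
  -- The scale is `c = 1/√n`, so the Gaussian comparison vector `c • √n • a` is `a` itself.
  have clt := hh.abs_integral_sum_sub_le lawU indU integrable_id_scoreVector
    (hh.abs_integral_sub_integral_le memLp_three_scoreVector memLp_three_stdGaussian
      (fun i => by rw [integral_scoreVector, integral_eval_stdGaussian])
      (fun i j => by rw [integral_scoreVector_mul, integral_eval_mul_stdGaussian])
      (inv_nonneg.2 hr.le)) Finset.univ 0
  simp only [zero_add, Finset.card_univ, Fintype.card_fin, inv_smul_smul₀ hr.ne'] at clt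
  -- There are `n` replacements of order `n^{-3/2}`; the third moments sum to at most `40 + 16 ≤
  -- 60`, and `60/6 = 10`.
  have rate : (n : ℝ) * ((√(n : ℝ))⁻¹ ^ 3 * (supNorm₃ h).toReal / 6 *
      (∫ a : EuclideanSpace ℝ (Fin 2), (∑ i, |a i|) ^ 3 ∂((gaussianReal 0 1).map scoreVector)
        + ∫ a, (∑ i, |a i|) ^ 3 ∂(stdGaussian (EuclideanSpace ℝ (Fin 2)))))
      ≤ 10 / √n * (supNorm₃ h).toReal := by
    have hM : 0 ≤ (supNorm₃ h).toReal := ENNReal.toReal_nonneg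
    calc _ ≤ (n : ℝ) * ((√(n : ℝ))⁻¹ ^ 3 * (supNorm₃ h).toReal / 6 * 60) := by
          gcongr
          linarith [integral_abs_scoreVector_pow_three_le, integral_abs_stdGaussian_pow_three_le]
      _ = _ := by
          nth_rewrite 1 [← hn']
          field_simp
          ring
  have tri := abs_sub_le (∫ ω, h (W ω + EuclideanSpace.single 1 (-(R ω ^ 2 / (√2 * √n)))) ∂P)
    (∫ ω, h (W ω) ∂P) (∫ z, h z ∂(stdGaussian (EuclideanSpace ℝ (Fin 2))))
  linarith [clt.trans rate]

end NormalMLE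

/-! ### Assembly of both parts. -/

theorem mainTheorem4 {Ω Ω' : Type*} [MeasurableSpace Ω] [MeasurableSpace Ω']
    (P : Measure Ω) [IsProbabilityMeasure P] (Q : Measure Ω') [IsProbabilityMeasure Q]
    (n : ℕ) (hn : 1 ≤ n) (μ σ : ℝ) (hσ : 0 < σ)
    (θ₀ : EuclideanSpace ℝ (Fin 2)) (hθ₀ : θ₀ = !₂[μ, σ ^ 2])
    (X : Fin n → Ω → ℝ) (hlaw : ∀ i, HasLaw (X i) (NormalMLE.law θ₀) P) (hindep : iIndepFun X P)
    (Z : Ω' → EuclideanSpace ℝ (Fin 2))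
    (hZ : HasLaw Z (stdGaussian (EuclideanSpace ℝ (Fin 2))) Q)
    (θhat : Ω → EuclideanSpace ℝ (Fin 2))
    (hθhat : ∀ ω, θhat ω = NormalMLE.estimator fun i => X i ω) :
    (2 ≤ n → ∀ᵐ ω ∂P, ∀ t, NormalMLE.IsMLE (fun i => X i ω) t ↔ t = θhat ω) ∧
    ∀ h : EuclideanSpace ℝ (Fin 2) → ℝ, NormalMLE.IsTestFunction h →
      Integrable (fun ω => h (NormalMLE.standardize n θ₀ (θhat ω))) P ∧
      Integrable (fun ω => h (Z ω)) Q ∧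
      ENNReal.ofReal |∫ ω, h (NormalMLE.standardize n θ₀ (θhat ω)) ∂P - ∫ ω, h (Z ω) ∂Q| ≤
        ENNReal.ofReal (5 / 2 / √n) * NormalMLE.supNorm₂ h
        + ENNReal.ofReal (19 / √n) * NormalMLE.supNorm₃ h
        + ENNReal.ofReal (8 / (n * σ ^ 2) * (1 + 2 * σ ^ 2)) * NormalMLE.supNorm h
        + ENNReal.ofReal (4 * √2 / √n) * NormalMLE.supNorm₁ h
        + ENNReal.ofReal (4 / √n * (√2 + √(3 / 2) + 16 * √2 * √(1 / n + σ ^ 2 / 4)))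
          * NormalMLE.supNorm₁ h
        + ENNReal.ofReal (32 / √n * √(1 + 648 * ((3 / 2 + σ ^ 2 / 4) ^ 2 + 3 / (n : ℝ) ^ 2)))
          * NormalMLE.supNorm₁ h := by

  have hn0 : n ≠ 0 := by omega
  have hr : 0 < √(n : ℝ) := Real.sqrt_pos.2 (by positivity)
  have hv : (θ₀ 1).toNNReal ≠ 0 := by
    simpa [hθ₀] using hσ.ne'
  have hprob : IsProbabilityMeasure (NormalMLE.law θ₀) := by
    unfold NormalMLE.law; infer_instance
  have hnull : NullSingletonClass (NormalMLE.law θ₀) := nullSingletonClass_gaussianReal hv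
  obtain rfl : θhat = fun ω => NormalMLE.estimator fun i => X i ω := funext hθhat
  refine ⟨fun h2 => ?_, fun h hh => ?_⟩
  -- Two distinct indices exist because `n ≥ 2`; a single observation would have zero sample
  -- variance.
  · have hne : (⟨0, by omega⟩ : Fin n) ≠ ⟨1, by omega⟩ := by simp
    filter_upwards [NormalMLE.ae_ne_of_indepFun (hlaw _) (hlaw _) (hindep.indepFun hne)] with ω hω
    exact NormalMLE.isMLE_iff hn0 (NormalMLE.estimator_one_pos hω)
  · obtain ⟨hint, hle⟩ :=
      NormalMLE.abs_integral_standardize_estimator_sub_le hn0 hσ hθ₀ hlaw hindep hh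
    have hZi : Integrable (fun z => h z) (stdGaussian (EuclideanSpace ℝ (Fin 2))) :=
      hh.integrable_comp IsGaussian.integrable_id
    have hZe : ∫ ω, h (Z ω) ∂Q = ∫ z, h z ∂(stdGaussian (EuclideanSpace ℝ (Fin 2))) :=
      hZ.integral_comp hZi.1
    refine ⟨hint, ?_, ?_⟩
    · rw [← hZ.map_eq] at hZi
      exact hZi.comp_aemeasurable hZ.aemeasurable
    · rw [hZe]
      have h₁ : ENNReal.ofReal (1 / √n * (NormalMLE.supNorm₁ h).toReal)
          ≤ ENNReal.ofReal (4 * √2 / √n) * NormalMLE.supNorm₁ h := by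
        rw [ENNReal.ofReal_mul (by positivity), ENNReal.ofReal_toReal hh.bounded_first.ne]
        gcongr
        linarith [Real.one_le_sqrt.2 (show (1 : ℝ) ≤ 2 by norm_num)]
      have h₃ : ENNReal.ofReal (10 / √n * (NormalMLE.supNorm₃ h).toReal)
          ≤ ENNReal.ofReal (19 / √n) * NormalMLE.supNorm₃ h := by
        rw [ENNReal.ofReal_mul (by positivity), ENNReal.ofReal_toReal hh.bounded_third.ne]
        gcongr
        norm_num
      refine (ENNReal.ofReal_le_ofReal hle).trans (ENNReal.ofReal_add_le.trans ?_)
      -- The other four terms are nonnegative and dropped; in `ℝ≥0∞` this covers the case `‖h‖ = ∞`.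
      refine (add_le_add h₃ h₁).trans (le_trans ?_ (le_self_add.trans le_self_add))
      gcongr
      exact le_add_self.trans le_self_add
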